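/- **Theorem (Intersection and Linking).** Let $n\ge 0$ be an integer and let $S\subset\mathbb R^n$ be a set of $n+3$ (distinct) points in general position, i.e. no $n+1$ points of $S$ lie in one affine hyperplane (an affine subspace of dimension $n-1$). A *$k$-simplex with vertices in $S$* is the convex hull of $k+1$ points of $S$ (its vertices); its *boundary* is the union of the convex hulls of the $k$-element subsets of its vertex set, and its *interior* is the simplex minus its boundary. Say that a simplex $\Delta$ is *linked* with a simplex $\Delta'$ if the boundary of $\Delta$ intersects $\Delta'$ at exactly one point. 1. If $n$ is even, then the number of points of $\mathbb R^n$ that lie in the interiors of two different $(n/2)$-simplices with vertices in $S$ is (finite and) odd. 2. If $n$ is odd, then for $((n+1)/2)$-simplices with vertices in $S$ and with disjoint vertex sets being linked is a symmetric relation, and the number of linked unordered pairs of $((n+1)/2)$-simplices with vertices in $S$ and with disjoint vertex sets is odd. -/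

import Mathlib

/-- A subset of `ℝⁿ` is in general position if no `n + 1` of its points lie in one hyperplane,
i.e. in one affine subspace of dimension `n - 1`. -/
def InGeneralPosition {n : ℕ} (S : Set (EuclideanSpace ℝ (Fin n))) : Prop :=
  ∀ A : Finset (EuclideanSpace ℝ (Fin n)), (A : Set (EuclideanSpace ℝ (Fin n))) ⊆ S →
    A.card = n + 1 →
      ¬ ∃ H : AffineSubspace ℝ (EuclideanSpace ℝ (Fin n)),
        Module.finrank ℝ H.direction + 1 = n ∧ ∀ x ∈ A, x ∈ H

/-- The simplex with vertex set `s`: the convex hull of `s`. It is a `k`-simplex when `s` has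
`k + 1` points. -/
def simplexOn {n : ℕ} (s : Finset (EuclideanSpace ℝ (Fin n))) :
    Set (EuclideanSpace ℝ (Fin n)) :=
  convexHull ℝ (s : Set (EuclideanSpace ℝ (Fin n)))

open Classical in
/-- The boundary (outline, surface) of the simplex with vertex set `s`: the union of its facets. -/
def simplexBoundary {n : ℕ} (s : Finset (EuclideanSpace ℝ (Fin n))) :
    Set (EuclideanSpace ℝ (Fin n)) :=
  ⋃ v ∈ s, simplexOn (s.erase v)

/-- The (relative) interior of the simplex with vertex set `s`. -/
def simplexInterior {n : ℕ} (s : Finset (EuclideanSpace ℝ (Fin n))) :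
    Set (EuclideanSpace ℝ (Fin n)) :=
  simplexOn s \ simplexBoundary s

/-- The set of `k`-simplices with vertices in `S`, each given by its vertex set. -/
def simplicesOn {n : ℕ} (S : Finset (EuclideanSpace ℝ (Fin n))) (k : ℕ) :
    Set (Finset (EuclideanSpace ℝ (Fin n))) :=
  {s | s ⊆ S ∧ s.card = k + 1}

/-- The intersection points of the interiors of two different `k`-simplices with vertices
in `S`. -/
def interiorIntersectionPoints {n : ℕ} (S : Finset (EuclideanSpace ℝ (Fin n))) (k : ℕ) :
    Set (EuclideanSpace ℝ (Fin n)) :=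
  {x | ∃ s ∈ simplicesOn S k, ∃ t ∈ simplicesOn S k, s ≠ t ∧
    x ∈ simplexInterior s ∧ x ∈ simplexInterior t}

/-- The simplex on `s` is linked with the simplex on `t`: the boundary of the first one intersects
the second one at exactly one point. (Used for disjoint `s`, `t` with `s ∪ t` in general position
and for `k`-simplices in `ℝ^(2k-1)`.) -/
def Linked {n : ℕ} (s t : Finset (EuclideanSpace ℝ (Fin n))) : Prop :=
  ∃! x, x ∈ simplexBoundary s ∩ simplexOn t

/-- The linked unordered pairs of `k`-simplices with vertices in `S` and without common vertices. -/
def linkedPairs {n : ℕ} (S : Finset (EuclideanSpace ℝ (Fin n))) (k : ℕ) :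
    Set (Sym2 (Finset (EuclideanSpace ℝ (Fin n)))) :=
  {z | ∃ s ∈ simplicesOn S k, ∃ t ∈ simplicesOn S k, Disjoint s t ∧ Linked s t ∧ z = s(s, t)}

/-! The affine dependences on `S` form a plane, and general position says that a nonzero one
vanishes at no more than one point. The plane can be written as a pencil `a * (θ - t)` up to scale
(plus the multiples of `a`), with `a` nowhere zero and `θ` injective. The dependence vanishing at
`p` is then, up to scale, `a * (θ - θ p)`, and its two sign classes are the Radon partition of `S \
{p}`. Every intersection in the theorem is read off from these signs, so geometry becomes counting
along the order of `θ`.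

For `n = 2k`, two different `k`-simplices with meeting interiors are disjoint and omit exactly one
point `p`; they are the two sides at `p`, and both have `k + 1` points. Walk through `S` in the
order of `θ` with steps `signOf a`. The sides at `p` are balanced exactly when the step at `p`
passes half the final height `T`. Since `T` is odd, the walk starts and ends on different sides of
`T / 2`, so it passes this level an odd number of times (`odd_card_filter_crossing`).

For `n = 2k - 1`, disjoint `k`-simplices `s`, `t` partition `S`. Change the sign of `a` outside `s`.
The facet of `s` opposite `p` meets `t` exactly when the planar vector `z p • (1, θ p)` has all the
others on one side. Such extremal points come in pairs, the angularly first and last vectors of a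
family in a half-plane, or do not exist. So linking means that one of the pair lies in `s` and the
other in `t`, which is symmetric. It also means that `s` contains an odd number of extremal points,
so modulo 2 the linked pairs are counted by incidences of a point with a set, and summing over the
points first leads again to the walk. -/

/-! ### Affine dependences and general position -/

/-- `w` is an affine dependence between the points of `S`. -/
def IsAffineDependence {n : ℕ} (S : Finset (EuclideanSpace ℝ (Fin n)))
    (w : EuclideanSpace ℝ (Fin n) → ℝ) : Prop :=
  ∑ x ∈ S, w x = 0 ∧ ∑ x ∈ S, w x • x = 0

/-- Every affine dependence on `S` that vanishes at two points of `S` vanishes on `S`. -/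
def HasRigidDependences {n : ℕ} (S : Finset (EuclideanSpace ℝ (Fin n))) : Prop :=
  ∀ w, IsAffineDependence S w → ∀ p ∈ S, ∀ q ∈ S, p ≠ q → w p = 0 → w q = 0 → ∀ x ∈ S, w x = 0

namespace IsAffineDependence

variable {n : ℕ} {S : Finset (EuclideanSpace ℝ (Fin n))} {v w : EuclideanSpace ℝ (Fin n) → ℝ}

theorem add (hv : IsAffineDependence S v) (hw : IsAffineDependence S w) :
    IsAffineDependence S (fun x => v x + w x) := by
  refine ⟨?_, ?_⟩
  · rw [Finset.sum_add_distrib, hv.1, hw.1, add_zero]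
  · simp only [add_smul]
    rw [Finset.sum_add_distrib, hv.2, hw.2, add_zero]

theorem const_mul (c : ℝ) (hv : IsAffineDependence S v) :
    IsAffineDependence S (fun x => c * v x) := by
  refine ⟨?_, ?_⟩
  · rw [← Finset.mul_sum, hv.1, mul_zero]
  · simp only [mul_smul]
    rw [← Finset.smul_sum, hv.2, smul_zero]

theorem congr (hv : IsAffineDependence S v) (h : ∀ x ∈ S, v x = w x) :
    IsAffineDependence S w := by
  refine ⟨?_, ?_⟩
  · rw [← hv.1]
    exact Finset.sum_congr rfl fun x hx => (h x hx).symm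
  · rw [← hv.2]
    exact Finset.sum_congr rfl fun x hx => by rw [h x hx]

theorem exists_eq_mul (hS : HasRigidDependences S) (hv : IsAffineDependence S v)
    (hw : IsAffineDependence S w) {p : EuclideanSpace ℝ (Fin n)} (hp : p ∈ S) (hvp : v p = 0)
    (hwp : w p = 0) (hne : ∃ x ∈ S, w x ≠ 0) : ∃ c : ℝ, ∀ x ∈ S, v x = c * w x := by
  obtain ⟨q, hq, hwq⟩ := hne
  have hpq : p ≠ q := by
    rintro rfl
    exact hwq hwp
  refine ⟨v q / w q, fun x hx => ?_⟩
  have h := hS _ (hv.add (hw.const_mul (-(v q / w q)))) p hp q hq hpq (by simp [hvp, hwp])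
    (by field_simp; ring) x hx
  linarith

end IsAffineDependence

/-- Points in general position have rigid affine dependences. -/
theorem hasRigidDependences_of_inGeneralPosition {n : ℕ}
    {S : Finset (EuclideanSpace ℝ (Fin n))} (hcard : S.card = n + 3)
    (hS : InGeneralPosition (S : Set (EuclideanSpace ℝ (Fin n)))) : HasRigidDependences S := by
  intro w hw p hp q hq hpq hwp hwq x hx
  by_contra hwx
  set A := (S.erase p).erase q with hA
  have hqA : q ∈ S.erase p := Finset.mem_erase.2 ⟨hpq.symm, hq⟩
  have hAcard : A.card = n + 1 := by
    rw [hA, Finset.card_erase_of_mem hqA, Finset.card_erase_of_mem hp, hcard]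
    rfl
  have hAS : A ⊆ S := (Finset.erase_subset _ _).trans (Finset.erase_subset _ _)
  have hxA : x ∈ A := by
    simp only [hA, Finset.mem_erase]
    refine ⟨?_, ?_, hx⟩ <;> rintro rfl <;> contradiction
  have hoff : ∀ y ∈ S, y ∉ A → w y = 0 := by
    intro y hy hyA
    simp only [hA, Finset.mem_erase, not_and] at hyA
    by_cases h1 : y = q
    · rw [h1, hwq]
    · by_cases h2 : y = p
      · rw [h2, hwp]
      · exact absurd hy (hyA h1 h2)
  have hsum : ∑ y ∈ A, w y = 0 := by
    rw [Finset.sum_subset hAS hoff, hw.1]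
  have hsum' : ∑ y ∈ A, w y • y = 0 := by
    rw [Finset.sum_subset hAS fun y hy hyA => by rw [hoff y hy hyA, zero_smul], hw.2]
  obtain ⟨m, rfl⟩ : ∃ m, n = m + 1 := by
    refine Nat.exists_eq_succ_of_ne_zero ?_
    rintro rfl
    exact hpq (Subsingleton.elim _ _)
  have hdep : ¬ AffineIndependent ℝ (fun y : A => (y : EuclideanSpace ℝ (Fin (m + 1)))) := by
    intro h
    rw [affineIndependent_iff] at h
    refine hwx (h Finset.univ (fun y => w y) ?_ ?_ ⟨x, hxA⟩ (Finset.mem_univ _))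
    · rw [← hsum]
      exact Finset.sum_coe_sort A w
    · rw [← hsum']
      exact Finset.sum_coe_sort A fun y => w y • y
  rw [affineIndependent_iff_not_finrank_vectorSpan_le ℝ _ (n := m) (by simp [hAcard]),
    not_not] at hdep
  have hrange : Set.range (fun y : A => (y : EuclideanSpace ℝ (Fin (m + 1)))) = A := by
    simp
  rw [hrange] at hdep
  have hlt : vectorSpan ℝ (A : Set (EuclideanSpace ℝ (Fin (m + 1)))) < ⊤ := by
    rw [lt_top_iff_ne_top]
    intro htop
    rw [htop, finrank_top, finrank_euclideanSpace_fin] at hdep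
    omega
  -- The span may have too small a dimension; the kernel of a nonzero functional enlarges it to a
  -- hyperplane of dimension exactly `n - 1`.
  obtain ⟨f, hf, hle⟩ := Submodule.exists_le_ker_of_lt_top _ hlt
  refine hS A (by exact_mod_cast hAS) hAcard ⟨AffineSubspace.mk' x f.ker, ?_, ?_⟩
  · rw [AffineSubspace.direction_mk']
    have := Module.Dual.finrank_ker_add_one_of_ne_zero hf
    rwa [finrank_euclideanSpace_fin] at this
  · intro y hy
    rw [AffineSubspace.mem_mk']
    exact hle (vsub_mem_vectorSpan ℝ (by exact_mod_cast hy) (by exact_mod_cast hxA))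

/-! ### The pencil of dependences -/

/-- A presentation of the two-dimensional space of affine dependences on `S`: a nowhere zero
dependence `a` and an injective parameter `θ` such that all `a * (θ - t)` are dependences. -/
structure IsDependencePencil {n : ℕ} (S : Finset (EuclideanSpace ℝ (Fin n)))
    (a θ : EuclideanSpace ℝ (Fin n) → ℝ) : Prop where
  ne_zero : ∀ x ∈ S, a x ≠ 0
  injOn : Set.InjOn θ S
  dependence : ∀ t, IsAffineDependence S (fun x => a x * (θ x - t))

/-- Removing a point leaves `n + 2` points, still affinely dependent; rigidity makes the resulting
dependence vanish only at the removed point. Two of these span the pencil. -/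
theorem HasRigidDependences.exists_isDependencePencil {n : ℕ}
    {S : Finset (EuclideanSpace ℝ (Fin n))} (hcard : S.card = n + 3)
    (hS : HasRigidDependences S) : ∃ a θ, IsDependencePencil S a θ := by
  have key : ∀ p ∈ S, ∃ v, IsAffineDependence S v ∧ v p = 0 ∧ ∀ x ∈ S, x ≠ p → v x ≠ 0 := by
    intro p hp
    obtain ⟨f, hf1, hf2, x, hx, hfx⟩ :=
      Module.exists_nontrivial_relation_sum_zero_of_finrank_succ_lt_card (R := ℝ)
        (t := S.erase p) (by
          rw [finrank_euclideanSpace_fin, Finset.card_erase_of_mem hp, hcard]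
          omega)
    have hdep : IsAffineDependence S (fun x => if x = p then 0 else f x) := by
      refine ⟨?_, ?_⟩
      · rw [← Finset.add_sum_erase S _ hp, if_pos rfl, zero_add, ← hf2]
        exact Finset.sum_congr rfl fun y hy => if_neg (Finset.ne_of_mem_erase hy)
      · rw [← Finset.add_sum_erase S _ hp]
        simp only [if_true, zero_smul, zero_add]
        rw [← hf1]
        exact Finset.sum_congr rfl fun y hy => by
          simp only [if_neg (Finset.ne_of_mem_erase hy)]
    refine ⟨_, hdep, if_pos rfl, fun y hy hyp h0 => hfx ?_⟩
    have := hS _ hdep p hp y hy hyp.symm (if_pos rfl) h0 x (Finset.mem_of_mem_erase hx)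
    rwa [if_neg (Finset.ne_of_mem_erase hx)] at this
  obtain ⟨p, hp, r, hr, hpr⟩ := Finset.one_lt_card.1 (show 1 < S.card by omega)
  obtain ⟨v, hv, hvp, hvne⟩ := key p hp
  obtain ⟨w, hw, hwr, hwne⟩ := key r hr
  -- A generic combination `a = v + t * w` vanishes nowhere; with `θ = w / a`, the function `a * (θ
  -- - s)` is `w - s * a`.
  obtain ⟨t, ht⟩ := Infinite.exists_notMem_finset (insert 0 (S.image fun x => -(v x / w x)))
  simp only [Finset.mem_insert, Finset.mem_image, not_or, not_exists, not_and] at ht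
  obtain ⟨ht0, ht⟩ := ht
  have hne : ∀ x ∈ S, v x + t * w x ≠ 0 := by
    intro x hx h
    by_cases hxr : x = r
    · rw [hxr, hwr, mul_zero, add_zero] at h
      exact hvne r hr hpr.symm h
    · refine ht x hx ?_
      have := hwne x hx hxr
      field_simp
      linarith
  refine ⟨fun x => v x + t * w x, fun x => w x / (v x + t * w x), hne, ?_, ?_⟩
  · intro x hx y hy hxy
    by_contra hxy'
    simp only at hxy
    set c := w x / (v x + t * w x) with hc
    have hz := hS _ (hw.add ((hv.add (hw.const_mul t)).const_mul (-c))) x hx y hy hxy'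
      (by have := div_mul_cancel₀ (w x) (hne x hx); rw [← hc] at this; linarith)
      (by have := div_mul_cancel₀ (w y) (hne y hy); rw [← hxy] at this; linarith)
    have h1 := hz r hr
    have h2 := hz p hp
    simp only [hwr, hvp] at h1 h2
    have hc0 : c = 0 := by
      have := hvne r hr hpr.symm
      have h3 : c * v r = 0 := by linarith
      exact (mul_eq_zero.1 h3).resolve_right this
    rw [hc0] at h2
    exact hwne p hp hpr (by linarith)
  · intro s
    refine (hw.add ((hv.add (hw.const_mul t)).const_mul (-s))).congr fun x hx => ?_
    have := div_mul_cancel₀ (w x) (hne x hx)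
    linear_combination -this

/-! ### Barycentric coordinates -/

/-- `l` is a system of barycentric coordinates of `x` with respect to `S`, supported on `A`. -/
structure IsBarycentric {n : ℕ} (S A : Finset (EuclideanSpace ℝ (Fin n)))
    (x : EuclideanSpace ℝ (Fin n)) (l : EuclideanSpace ℝ (Fin n) → ℝ) : Prop where
  nonneg : ∀ y, 0 ≤ l y
  eq_zero : ∀ y ∉ A, l y = 0
  sum_eq : ∑ y ∈ S, l y = 1
  sum_smul : ∑ y ∈ S, l y • y = x

theorem mem_simplexOn_iff {n : ℕ} {S A : Finset (EuclideanSpace ℝ (Fin n))} (hA : A ⊆ S)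
    {x : EuclideanSpace ℝ (Fin n)} : x ∈ simplexOn A ↔ ∃ l, IsBarycentric S A x l := by
  rw [simplexOn, Finset.mem_convexHull']
  constructor
  · rintro ⟨w, h0, h1, h2⟩
    refine ⟨fun y => if y ∈ A then w y else 0, ?_, ?_, ?_, ?_⟩
    · intro y
      split_ifs with h
      exacts [h0 y h, le_rfl]
    · intro y hy
      exact if_neg hy
    · rw [← h1, ← Finset.sum_subset hA fun y _ hy => if_neg hy]
      exact Finset.sum_congr rfl fun y hy => if_pos hy
    · rw [← h2, ← Finset.sum_subset hA fun y _ hy => by rw [if_neg hy, zero_smul]]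
      exact Finset.sum_congr rfl fun y hy => by rw [if_pos hy]
  · rintro ⟨l, h0, h1, h2, h3⟩
    refine ⟨l, fun y _ => h0 y, ?_, ?_⟩
    · rw [Finset.sum_subset hA fun y _ hy => h1 y hy, h2]
    · rw [Finset.sum_subset hA fun y _ hy => by rw [h1 y hy, zero_smul], h3]

namespace IsBarycentric

variable {n : ℕ} {S A B : Finset (EuclideanSpace ℝ (Fin n))} {x : EuclideanSpace ℝ (Fin n)}
  {l m : EuclideanSpace ℝ (Fin n) → ℝ}

theorem dependence_sub (hl : IsBarycentric S A x l) (hm : IsBarycentric S B x m) :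
    IsAffineDependence S (fun y => l y - m y) := by
  refine ⟨?_, ?_⟩
  · rw [Finset.sum_sub_distrib, hl.sum_eq, hm.sum_eq, sub_self]
  · simp only [sub_smul]
    rw [Finset.sum_sub_distrib, hl.sum_smul, hm.sum_smul, sub_self]

theorem mono (hl : IsBarycentric S A x l) (h : A ⊆ B) : IsBarycentric S B x l :=
  ⟨hl.nonneg, fun y hy => hl.eq_zero y fun hyA => hy (h hyA), hl.sum_eq, hl.sum_smul⟩

theorem erase (hl : IsBarycentric S A x l) {v : EuclideanSpace ℝ (Fin n)} (hv : l v = 0) :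
    IsBarycentric S (A.erase v) x l := by
  refine ⟨hl.nonneg, fun y hy => ?_, hl.sum_eq, hl.sum_smul⟩
  by_cases hyv : y = v
  · rw [hyv, hv]
  · exact hl.eq_zero y fun hyA => hy (Finset.mem_erase.2 ⟨hyv, hyA⟩)

theorem eq_of_eq_at (hS : HasRigidDependences S) (hl : IsBarycentric S A x l)
    (hm : IsBarycentric S B x m) {p q : EuclideanSpace ℝ (Fin n)} (hp : p ∈ S) (hq : q ∈ S)
    (hpq : p ≠ q) (h1 : l p = m p) (h2 : l q = m q) : ∀ y ∈ S, l y = m y := fun y hy =>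
  sub_eq_zero.1 (hS _ (hl.dependence_sub hm) p hp q hq hpq (sub_eq_zero.2 h1)
    (sub_eq_zero.2 h2) y hy)

theorem exists_pos (hl : IsBarycentric S A x l) : ∃ y ∈ A, 0 < l y := by
  by_contra! h
  have : ∑ y ∈ S, l y = 0 := Finset.sum_eq_zero fun y _ => by
    by_cases hy : y ∈ A
    · exact le_antisymm (h y hy) (hl.nonneg y)
    · exact hl.eq_zero y hy
  rw [hl.sum_eq] at this
  exact one_ne_zero this

end IsBarycentric

theorem mem_simplexBoundary_iff {n : ℕ} {s : Finset (EuclideanSpace ℝ (Fin n))}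
    {x : EuclideanSpace ℝ (Fin n)} :
    x ∈ simplexBoundary s ↔ ∃ v ∈ s, x ∈ simplexOn (s.erase v) := by
  simp only [simplexBoundary, Set.mem_iUnion, exists_prop]

theorem exists_isBarycentric_pos_of_mem_simplexInterior {n : ℕ}
    {S A : Finset (EuclideanSpace ℝ (Fin n))} (hA : A ⊆ S) {x : EuclideanSpace ℝ (Fin n)}
    (hx : x ∈ simplexInterior A) : ∃ l, IsBarycentric S A x l ∧ ∀ y ∈ A, 0 < l y := by
  obtain ⟨l, hl⟩ := (mem_simplexOn_iff hA).1 hx.1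
  refine ⟨l, hl, fun y hy => (hl.nonneg y).lt_of_ne' fun h => hx.2 ?_⟩
  exact mem_simplexBoundary_iff.2
    ⟨y, hy, (mem_simplexOn_iff ((Finset.erase_subset _ _).trans hA)).2 ⟨l, hl.erase h⟩⟩

/-- Two points of `S` outside `A` make coordinates supported on `A` unique, so positive ones cannot
be replaced by coordinates on a facet. -/
theorem mem_simplexInterior_of_isBarycentric {n : ℕ}
    {S A : Finset (EuclideanSpace ℝ (Fin n))} (hS : HasRigidDependences S) (hA : A ⊆ S)
    (hcard : A.card + 2 ≤ S.card) {x : EuclideanSpace ℝ (Fin n)}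
    {l : EuclideanSpace ℝ (Fin n) → ℝ} (hl : IsBarycentric S A x l) (hpos : ∀ y ∈ A, 0 < l y) :
    x ∈ simplexInterior A := by
  refine ⟨(mem_simplexOn_iff hA).2 ⟨l, hl⟩, fun hb => ?_⟩
  obtain ⟨v, hv, hx⟩ := mem_simplexBoundary_iff.1 hb
  obtain ⟨m, hm⟩ := (mem_simplexOn_iff ((Finset.erase_subset _ _).trans hA)).1 hx
  obtain ⟨p, hp, q, hq, hpq⟩ := Finset.one_lt_card.1
    (show 1 < (S \ A).card by rw [Finset.card_sdiff_of_subset hA]; omega)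
  rw [Finset.mem_sdiff] at hp hq
  have hm' := hm.mono (Finset.erase_subset v A)
  have := hl.eq_of_eq_at hS hm' hp.1 hq.1 hpq
    (by rw [hl.eq_zero p hp.2, hm'.eq_zero p hp.2])
    (by rw [hl.eq_zero q hq.2, hm'.eq_zero q hq.2]) v (hA hv)
  rw [hm.eq_zero v (Finset.notMem_erase v A)] at this
  exact (hpos v hv).ne' this

/-! ### Level crossings and sign counts -/

/-- A walk with steps `ε = ±1`, indexed by `S` in the order of `θ`, passes the half-integer level
`L / 2` an odd number of times if and only if its endpoints lie on different sides. -/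
theorem odd_card_filter_crossing {ι : Type*} (S : Finset ι) (θ : ι → ℝ)
    (hθ : Set.InjOn θ S) (ε : ι → ℤ) (hε : ∀ x ∈ S, ε x = 1 ∨ ε x = -1) (L : ℤ) (hL : Odd L) :
    Odd (S.filter fun p => 2 * (∑ q ∈ S with θ q < θ p, ε q) + ε p = L).card ↔
      ¬ (L < 0 ↔ L < 2 * ∑ q ∈ S, ε q) := by
  classical
  -- Appending the step with the largest parameter leaves earlier heights alone and passes the level
  -- exactly when it moves the endpoint across it.
  induction S using Finset.induction_on_max_value θ with
  | empty => simp
  | insert m S hm hmax ih =>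
    have hlt : ∀ x ∈ S, θ x < θ m := fun x hx => (hmax x hx).lt_of_ne fun h =>
      hm (hθ (by simp [hx]) (by simp) h ▸ hx)
    have ih := ih (hθ.mono (by simp)) fun x hx => hε x (Finset.mem_insert_of_mem hx)
    have h1 : ∀ p ∈ S, (insert m S).filter (fun q => θ q < θ p) = S.filter fun q => θ q < θ p := by
      intro p hp
      rw [Finset.filter_insert, if_neg (hlt p hp).not_gt]
    have h2 : (insert m S).filter (fun q => θ q < θ m) = S := by
      rw [Finset.filter_insert, if_neg (lt_irrefl _)]
      exact Finset.filter_true_of_mem hlt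
    have h3 : S.filter (fun p => 2 * (∑ q ∈ insert m S with θ q < θ p, ε q) + ε p = L) =
        S.filter fun p => 2 * (∑ q ∈ S with θ q < θ p, ε q) + ε p = L :=
      Finset.filter_congr fun p hp => by rw [h1 p hp]
    have hεm := hε m (Finset.mem_insert_self _ _)
    rw [Finset.sum_insert hm, Finset.filter_insert, h2, h3]
    split_ifs with h
    · rw [Finset.card_insert_of_notMem (by simp [hm]), Nat.odd_add_one, ih]
      rcases hεm with e | e <;> rw [e] at h ⊢ <;> grind
    · rw [ih]
      obtain ⟨j, rfl⟩ := hL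
      rcases hεm with e | e <;> rw [e] at h ⊢ <;> grind

/-- `1` where `a` is positive, `-1` elsewhere. -/
noncomputable def signOf {ι : Type*} (a : ι → ℝ) (q : ι) : ℤ := if 0 < a q then 1 else -1

theorem signOf_eq_or {ι : Type*} (a : ι → ℝ) (q : ι) : signOf a q = 1 ∨ signOf a q = -1 := by
  unfold signOf
  split_ifs <;> simp

/-- A point above `p` contributes its sign, a point below `p` the opposite sign, and `p` itself
nothing. The bracket is twice the height at the middle of the step at `p`. -/
theorem card_pos_sub_card_neg {ι : Type*} (S : Finset ι) (a θ : ι → ℝ)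
    (ha : ∀ x ∈ S, a x ≠ 0) (hθ : Set.InjOn θ S) {p : ι} (hp : p ∈ S) :
    ((S.filter fun q => 0 < a q * (θ q - θ p)).card : ℤ) -
      (S.filter fun q => a q * (θ q - θ p) < 0).card =
      ∑ q ∈ S, signOf a q - (2 * (∑ q ∈ S with θ q < θ p, signOf a q) + signOf a p) := by
  classical
  have h : signOf a p = ∑ q ∈ S, if q = p then signOf a q else 0 := by
    rw [Finset.sum_ite_eq' S p, if_pos hp]
  rw [h, Finset.card_filter, Finset.card_filter, Finset.sum_filter, Finset.mul_sum,
    ← Finset.sum_add_distrib, ← Finset.sum_sub_distrib]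
  push_cast
  rw [← Finset.sum_sub_distrib]
  refine Finset.sum_congr rfl fun q hq => ?_
  rcases lt_trichotomy (θ q) (θ p) with hlt | heq | hgt
  · have hqp : q ≠ p := by rintro rfl; exact lt_irrefl _ hlt
    have h' : θ q - θ p < 0 := by linarith
    rcases (ha q hq).lt_or_gt with hn | hn
    · have := mul_pos_of_neg_of_neg hn h'
      simp [signOf, hlt, hqp, this, this.not_gt, hn.not_gt]
    · have := mul_neg_of_pos_of_neg hn h'
      simp [signOf, hlt, hqp, this, this.not_gt, hn]
  · have hqp : q = p := hθ hq hp heq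
    subst hqp
    simp
  · have hqp : q ≠ p := by rintro rfl; exact lt_irrefl _ hgt
    have h' : 0 < θ q - θ p := by linarith
    rcases (ha q hq).lt_or_gt with hn | hn
    · have := mul_neg_of_neg_of_pos hn h'
      simp [signOf, hgt.not_gt, hqp, this, this.not_gt, hn.not_gt]
    · have := mul_pos hn h'
      simp [signOf, hgt.not_gt, hqp, this, this.not_gt, hn]

theorem card_pos_add_card_neg {ι : Type*} (S : Finset ι) (a θ : ι → ℝ)
    (ha : ∀ x ∈ S, a x ≠ 0) (hθ : Set.InjOn θ S) {p : ι} (hp : p ∈ S) :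
    (S.filter fun q => 0 < a q * (θ q - θ p)).card +
      (S.filter fun q => a q * (θ q - θ p) < 0).card + 1 = S.card := by
  classical
  rw [← Finset.card_erase_add_one hp, ← Finset.card_union_of_disjoint]
  · congr 2
    ext q
    simp only [Finset.mem_union, Finset.mem_filter, Finset.mem_erase]
    rw [← and_or_left, or_comm, ← ne_iff_lt_or_gt, and_comm, and_congr_left_iff]
    intro hq
    rw [mul_ne_zero_iff, sub_ne_zero, (hθ.ne_iff hq hp), and_iff_right (ha q hq)]
  · rw [Finset.disjoint_filter]
    intro q _ h1 h2
    exact lt_asymm h1 h2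

theorem even_sum_signOf_iff {ι : Type*} (S : Finset ι) (a : ι → ℝ) :
    Even (∑ q ∈ S, signOf a q) ↔ Even S.card := by
  classical
  induction S using Finset.induction_on with
  | empty => simp
  | insert m S hm ih =>
    rw [Finset.sum_insert hm, Finset.card_insert_of_notMem hm, Int.even_add, ih, Nat.even_add_one]
    rcases signOf_eq_or a m with h | h <;> simp [h]

/-! ### Sources and sinks of planar vectors -/

/-- A source of the tournament `0 < z p * z q * (θ q - θ p)` forces a sink. -/
theorem exists_sink_of_source {ι : Type*} (S : Finset ι) (z θ : ι → ℝ) (hz : ∀ x ∈ S, z x ≠ 0)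
    (hθ : Set.InjOn θ S)
    (h : ∃ p ∈ S, ∀ q ∈ S, q ≠ p → 0 < z p * (z q * (θ q - θ p))) :
    ∃ p ∈ S, ∀ q ∈ S, q ≠ p → z p * (z q * (θ q - θ p)) < 0 := by
  classical
  obtain ⟨p, hp, hsrc⟩ := h
  have habove : ∀ q ∈ S, θ p ≤ θ q → 0 < z p * z q := by
    intro q hq hle
    by_cases hqp : q = p
    · rw [hqp]
      exact mul_self_pos.2 (hz p hp)
    · have := hsrc q hq hqp
      rw [← mul_assoc] at this
      exact pos_of_mul_pos_left this (by linarith)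
  have hbelow : ∀ q ∈ S, θ q < θ p → z p * z q < 0 := by
    intro q hq hlt
    have := hsrc q hq (by rintro rfl; exact lt_irrefl _ hlt)
    rw [← mul_assoc] at this
    nlinarith
  have hmul : ∀ {q r}, q ∈ S → r ∈ S → 0 < (z p * z q) * (z p * z r) → 0 < z q * z r := by
    intro q r hq hr h
    have : (z p * z q) * (z p * z r) = (z p * z p) * (z q * z r) := by ring
    rw [this] at h
    exact pos_of_mul_pos_right h (mul_self_nonneg _)
  have hmul' : ∀ {q r}, q ∈ S → r ∈ S → (z p * z q) * (z p * z r) < 0 → z q * z r < 0 := by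
    intro q r hq hr h
    have : (z p * z q) * (z p * z r) = (z p * z p) * (z q * z r) := by ring
    rw [this] at h
    exact (pos_iff_neg_of_mul_neg h).1 (mul_self_pos.2 (hz p hp))
  -- Turning from the vector of `p`, one meets first the points above `p`, with the sign of `z p`,
  -- then those below it, with the opposite sign. The last vector is the highest point below `p`, or
  -- the highest of all if there is none below.
  by_cases hmin : ∃ q ∈ S, θ q < θ p
  · obtain ⟨r, hr, hrmax⟩ := (S.filter fun q => θ q < θ p).exists_max_image θ
      (by obtain ⟨q, hq, hlt⟩ := hmin; exact ⟨q, Finset.mem_filter.2 ⟨hq, hlt⟩⟩)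
    rw [Finset.mem_filter] at hr
    refine ⟨r, hr.1, fun q hq hqr => ?_⟩
    rw [← mul_assoc]
    rcases lt_or_ge (θ q) (θ p) with hlt | hle
    · have h1 : θ q < θ r := (hrmax q (Finset.mem_filter.2 ⟨hq, hlt⟩)).lt_of_ne
        fun h => hqr (hθ hq hr.1 h)
      have := hmul hr.1 hq (mul_pos_of_neg_of_neg (hbelow r hr.1 hr.2) (hbelow q hq hlt))
      exact mul_neg_of_pos_of_neg this (by linarith)
    · have := hmul' hr.1 hq (mul_neg_of_neg_of_pos (hbelow r hr.1 hr.2) (habove q hq hle))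
      exact mul_neg_of_neg_of_pos this (by linarith [hr.2])
  · push Not at hmin
    obtain ⟨r, hr, hrmax⟩ := S.exists_max_image θ ⟨p, hp⟩
    refine ⟨r, hr, fun q hq hqr => ?_⟩
    rw [← mul_assoc]
    have h1 : θ q < θ r := (hrmax q hq).lt_of_ne fun h => hqr (hθ hq hr h)
    exact mul_neg_of_pos_of_neg
      (hmul hr hq (mul_pos (habove r hr (hmin r hr)) (habove q hq (hmin q hq)))) (by linarith)

theorem exists_source_of_sink {ι : Type*} (S : Finset ι) (z θ : ι → ℝ) (hz : ∀ x ∈ S, z x ≠ 0)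
    (hθ : Set.InjOn θ S)
    (h : ∃ p ∈ S, ∀ q ∈ S, q ≠ p → z p * (z q * (θ q - θ p)) < 0) :
    ∃ p ∈ S, ∀ q ∈ S, q ≠ p → 0 < z p * (z q * (θ q - θ p)) := by
  have := exists_sink_of_source S z (fun q => -θ q) hz
    (fun x hx y hy hxy => hθ hx hy (neg_injective hxy)) (by
      obtain ⟨p, hp, h⟩ := h
      refine ⟨p, hp, fun q hq hqp => ?_⟩
      have := h q hq hqp
      linear_combination this)
  obtain ⟨p, hp, h⟩ := this
  refine ⟨p, hp, fun q hq hqp => ?_⟩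
  have := h q hq hqp
  linear_combination this

/-! ### Radon partitions -/

theorem IsAffineDependence.exists_isBarycentric {n : ℕ}
    {S A B : Finset (EuclideanSpace ℝ (Fin n))} {w : EuclideanSpace ℝ (Fin n) → ℝ}
    (hw : IsAffineDependence S w) (hA : A ⊆ S) (hne : A.Nonempty)
    (hoff : ∀ q ∈ S, q ∉ A → q ∉ B → w q = 0) (hpos : ∀ q ∈ A, 0 < w q)
    (hneg : ∀ q ∈ B, w q < 0) :
    ∃ x l m, IsBarycentric S A x l ∧ IsBarycentric S B x m ∧
      (∀ q ∈ A, 0 < l q) ∧ ∀ q ∈ B, 0 < m q := by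
  set W := ∑ q ∈ A, w q with hW
  have hWpos : 0 < W := Finset.sum_pos hpos hne
  have hdisj : ∀ q ∈ A, q ∉ B := fun q h1 h2 => lt_asymm (hpos q h1) (hneg q h2)
  set l : EuclideanSpace ℝ (Fin n) → ℝ := fun q => if q ∈ A then W⁻¹ * w q else 0 with hl
  set m : EuclideanSpace ℝ (Fin n) → ℝ := fun q => if q ∈ B then -(W⁻¹ * w q) else 0 with hm
  have hlpos : ∀ q ∈ A, 0 < l q := fun q hq => by
    simp only [hl, if_pos hq]
    exact mul_pos (inv_pos.2 hWpos) (hpos q hq)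
  have hmpos : ∀ q ∈ B, 0 < m q := fun q hq => by
    simp only [hm, if_pos hq]
    exact neg_pos.2 (mul_neg_of_pos_of_neg (inv_pos.2 hWpos) (hneg q hq))
  have hl0 : ∀ q ∉ A, l q = 0 := fun q hq => if_neg hq
  have hm0 : ∀ q ∉ B, m q = 0 := fun q hq => if_neg hq
  have hlm : ∀ q ∈ S, W⁻¹ * w q = l q - m q := by
    intro q hq
    by_cases h1 : q ∈ A
    · simp [hl, hm, h1, hdisj q h1]
    · by_cases h2 : q ∈ B
      · simp [hl, hm, h1, h2]
      · simp [hl, hm, h1, h2, hoff q hq h1 h2]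
  have hdep := (hw.const_mul W⁻¹).congr hlm
  have hl1 : ∑ q ∈ S, l q = 1 := by
    rw [← Finset.sum_subset hA fun q _ hq => hl0 q hq,
      Finset.sum_congr rfl fun q hq => (if_pos hq : l q = W⁻¹ * w q), ← Finset.mul_sum, ← hW,
      inv_mul_cancel₀ hWpos.ne']
  have hd1 := hdep.1
  have hd2 := hdep.2
  simp only [sub_smul] at hd2
  rw [Finset.sum_sub_distrib, sub_eq_zero] at hd1 hd2
  refine ⟨∑ q ∈ S, l q • q, l, m, ⟨?_, hl0, hl1, rfl⟩, ⟨?_, hm0, ?_, hd2.symm⟩, hlpos, hmpos⟩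
  · intro q
    by_cases h : q ∈ A
    exacts [(hlpos q h).le, (hl0 q h).ge]
  · intro q
    by_cases h : q ∈ B
    exacts [(hmpos q h).le, (hm0 q h).ge]
  · rw [← hd1, hl1]

theorem IsDependencePencil.exists_eq_mul {n : ℕ} {S : Finset (EuclideanSpace ℝ (Fin n))}
    {a θ v : EuclideanSpace ℝ (Fin n) → ℝ} (h : IsDependencePencil S a θ)
    (hS : HasRigidDependences S) (hcard : 1 < S.card) (hv : IsAffineDependence S v)
    {p : EuclideanSpace ℝ (Fin n)} (hp : p ∈ S) (hvp : v p = 0) :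
    ∃ c : ℝ, ∀ x ∈ S, v x = c * (a x * (θ x - θ p)) := by
  obtain ⟨q, hq, hqp⟩ := Finset.exists_mem_ne hcard p
  exact hv.exists_eq_mul hS (h.dependence (θ p)) hp hvp (by simp)
    ⟨q, hq, mul_ne_zero (h.ne_zero q hq) (sub_ne_zero.2 fun e => hqp (h.injOn hq hp e))⟩

/-- The dependence of the pencil that vanishes at `p` is positive on one of `A` and `B` and
negative on the other one. -/
def SeparatesAt {ι : Type*} (a θ : ι → ℝ) (p : ι) (A B : Finset ι) : Prop :=
  ((∀ q ∈ A, 0 < a q * (θ q - θ p)) ∧ ∀ q ∈ B, a q * (θ q - θ p) < 0) ∨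
    ((∀ q ∈ A, a q * (θ q - θ p) < 0) ∧ ∀ q ∈ B, 0 < a q * (θ q - θ p))

section Pencil

variable {n : ℕ} {S A B : Finset (EuclideanSpace ℝ (Fin n))}
  {a θ : EuclideanSpace ℝ (Fin n) → ℝ} {p : EuclideanSpace ℝ (Fin n)}

theorem IsDependencePencil.exists_isBarycentric (h : IsDependencePencil S a θ)
    (hA : A ⊆ S) (hB : B ⊆ S) (hAne : A.Nonempty) (hBne : B.Nonempty)
    (hcover : ∀ q ∈ S, q ≠ p → q ∈ A ∨ q ∈ B) (hsep : SeparatesAt a θ p A B) :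
    ∃ x l m, IsBarycentric S A x l ∧ IsBarycentric S B x m ∧
      (∀ q ∈ A, 0 < l q) ∧ ∀ q ∈ B, 0 < m q := by
  have hoff : ∀ q ∈ S, q ∉ A → q ∉ B → a q * (θ q - θ p) = 0 := by
    intro q hq h1 h2
    have : q = p := by
      by_contra hqp
      rcases hcover q hq hqp with h' | h' <;> contradiction
    simp [this]
  rcases hsep with ⟨h1, h2⟩ | ⟨h1, h2⟩
  · exact (h.dependence (θ p)).exists_isBarycentric hA hAne hoff h1 h2
  · obtain ⟨x, l, m, hl, hm, hl', hm'⟩ := (h.dependence (θ p)).exists_isBarycentric hB hBne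
      (fun q hq hqB hqA => hoff q hq hqA hqB) h2 h1
    exact ⟨x, m, l, hm, hl, hm', hl'⟩

/-- The difference of the two coordinate systems of `x` vanishes at `p`, hence is a nonzero multiple
of the pencil member at `p`. That member vanishes only at `p`, so the weak signs are strict. -/
theorem IsDependencePencil.separatesAt (h : IsDependencePencil S a θ)
    (hS : HasRigidDependences S) (hcard : 1 < S.card) (hp : p ∈ S) (hA : A ⊆ S) (hB : B ⊆ S)
    (hdisj : Disjoint A B) (hpA : p ∉ A) (hpB : p ∉ B)
    {x : EuclideanSpace ℝ (Fin n)} (hxA : x ∈ simplexOn A) (hxB : x ∈ simplexOn B) :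
    SeparatesAt a θ p A B := by
  obtain ⟨l, hl⟩ := (mem_simplexOn_iff hA).1 hxA
  obtain ⟨m, hm⟩ := (mem_simplexOn_iff hB).1 hxB
  obtain ⟨c, hc⟩ := h.exists_eq_mul hS hcard (hl.dependence_sub hm) hp
    (by simp [hl.eq_zero p hpA, hm.eq_zero p hpB])
  have hne : ∀ q ∈ S, q ≠ p → a q * (θ q - θ p) ≠ 0 := fun q hq hqp =>
    mul_ne_zero (h.ne_zero q hq) (sub_ne_zero.2 fun e => hqp (h.injOn hq hp e))
  have hcne : c ≠ 0 := by
    rintro rfl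
    obtain ⟨y, hy, hly⟩ := hl.exists_pos
    have := hc y (hA hy)
    rw [hm.eq_zero y (Finset.disjoint_left.1 hdisj hy)] at this
    linarith
  have hA' : ∀ q ∈ A, 0 ≤ c * (a q * (θ q - θ p)) := by
    intro q hq
    rw [← hc q (hA hq), hm.eq_zero q (Finset.disjoint_left.1 hdisj hq), sub_zero]
    exact hl.nonneg q
  have hB' : ∀ q ∈ B, c * (a q * (θ q - θ p)) ≤ 0 := by
    intro q hq
    rw [← hc q (hB hq), hl.eq_zero q (Finset.disjoint_right.1 hdisj hq), zero_sub]
    exact neg_nonpos.2 (hm.nonneg q)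
  have hAne : ∀ q ∈ A, a q * (θ q - θ p) ≠ 0 := fun q hq =>
    hne q (hA hq) fun e => hpA (e ▸ hq)
  have hBne : ∀ q ∈ B, a q * (θ q - θ p) ≠ 0 := fun q hq =>
    hne q (hB hq) fun e => hpB (e ▸ hq)
  rcases hcne.lt_or_gt with hc0 | hc0
  · exact Or.inr ⟨fun q hq => (nonpos_of_mul_nonneg_right (hA' q hq) hc0).lt_of_ne (hAne q hq),
      fun q hq => (nonneg_of_mul_nonpos_right (hB' q hq) hc0).lt_of_ne' (hBne q hq)⟩
  · exact Or.inl ⟨fun q hq => (nonneg_of_mul_nonneg_right (hA' q hq) hc0).lt_of_ne' (hAne q hq),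
      fun q hq => (nonpos_of_mul_nonpos_right (hB' q hq) hc0).lt_of_ne (hBne q hq)⟩

end Pencil

/-- Two disjoint simplices that miss a point of `S` have at most one common point. -/
theorem HasRigidDependences.eq_of_mem_simplexOn {n : ℕ}
    {S A B : Finset (EuclideanSpace ℝ (Fin n))} (hS : HasRigidDependences S)
    {p : EuclideanSpace ℝ (Fin n)} (hp : p ∈ S) (hA : A ⊆ S) (hB : B ⊆ S) (hdisj : Disjoint A B)
    (hpA : p ∉ A) (hpB : p ∉ B) {x y : EuclideanSpace ℝ (Fin n)} (hxA : x ∈ simplexOn A)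
    (hxB : x ∈ simplexOn B) (hyA : y ∈ simplexOn A) (hyB : y ∈ simplexOn B) : x = y := by
  obtain ⟨l, hl⟩ := (mem_simplexOn_iff hA).1 hxA
  obtain ⟨m, hm⟩ := (mem_simplexOn_iff hB).1 hxB
  obtain ⟨l', hl'⟩ := (mem_simplexOn_iff hA).1 hyA
  obtain ⟨m', hm'⟩ := (mem_simplexOn_iff hB).1 hyB
  have hAB : ∀ q ∈ A, q ∉ B := fun _ hq => Finset.disjoint_left.1 hdisj hq
  obtain ⟨c, hc⟩ := (hl.dependence_sub hm).exists_eq_mul hS (hl'.dependence_sub hm') hp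
    (by simp [hl.eq_zero p hpA, hm.eq_zero p hpB])
    (by simp [hl'.eq_zero p hpA, hm'.eq_zero p hpB]) (by
      obtain ⟨z, hz, hlz⟩ := hl'.exists_pos
      refine ⟨z, hA hz, ?_⟩
      rw [hm'.eq_zero z (hAB z hz), sub_zero]
      exact hlz.ne')
  have hlc : ∀ q ∈ S, l q = c * l' q := by
    intro q hq
    by_cases hqA : q ∈ A
    · simpa [hm.eq_zero q (hAB q hqA), hm'.eq_zero q (hAB q hqA)] using hc q hq
    · rw [hl.eq_zero q hqA, hl'.eq_zero q hqA, mul_zero]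
  -- Both coordinate systems have total weight 1.
  have hc1 : c = 1 := by
    have := hl.sum_eq
    rw [Finset.sum_congr rfl hlc, ← Finset.mul_sum, hl'.sum_eq, mul_one] at this
    exact this
  rw [← hl.sum_smul, ← hl'.sum_smul]
  exact Finset.sum_congr rfl fun q hq => by rw [hlc q hq, hc1, one_mul]

/-! ### Even dimension: intersection points -/

/-- A common vertex would leave two points of `S` outside both simplices. The two coordinate systems
of `x` would then coincide, and so would their supports `s` and `t`. -/
theorem HasRigidDependences.disjoint_of_mem_simplexInterior {n : ℕ}
    {S s t : Finset (EuclideanSpace ℝ (Fin n))} (hS : HasRigidDependences S)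
    {k : ℕ} (hcard : S.card = 2 * k + 3) (hs : s ∈ simplicesOn S k) (ht : t ∈ simplicesOn S k)
    (hne : s ≠ t) {x : EuclideanSpace ℝ (Fin n)} (hxs : x ∈ simplexInterior s)
    (hxt : x ∈ simplexInterior t) : Disjoint s t := by
  obtain ⟨l, hl, hlpos⟩ := exists_isBarycentric_pos_of_mem_simplexInterior hs.1 hxs
  obtain ⟨m, hm, hmpos⟩ := exists_isBarycentric_pos_of_mem_simplexInterior ht.1 hxt
  by_contra hdisj
  have hinter : 0 < (s ∩ t).card := Finset.card_pos.2 (Finset.not_disjoint_iff_nonempty_inter.1 hdisj)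
  have h1 := Finset.card_union_add_card_inter s t
  have hs2 := hs.2
  have ht2 := ht.2
  obtain ⟨p, hp, q, hq, hpq⟩ := Finset.one_lt_card.1
    (show 1 < (S \ (s ∪ t)).card by
      rw [Finset.card_sdiff_of_subset (Finset.union_subset hs.1 ht.1)]; omega)
  simp only [Finset.mem_sdiff, Finset.mem_union, not_or] at hp hq
  have heq := hl.eq_of_eq_at hS hm hp.1 hq.1 hpq
    (by rw [hl.eq_zero p hp.2.1, hm.eq_zero p hp.2.2])
    (by rw [hl.eq_zero q hq.2.1, hm.eq_zero q hq.2.2])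
  refine hne (Finset.Subset.antisymm (fun y hy => ?_) fun y hy => ?_)
  · by_contra hyt
    have := hlpos y hy
    rw [heq y (hs.1 hy), hm.eq_zero y hyt] at this
    exact lt_irrefl _ this
  · by_contra hys
    have := hmpos y hy
    rw [← heq y (ht.1 hy), hl.eq_zero y hys] at this
    exact lt_irrefl _ this

theorem eq_filter_of_sign {ι : Type*} {S A B : Finset ι} {w : ι → ℝ} {p : ι} (hA : A ⊆ S)
    (hcover : ∀ q ∈ S, q ≠ p → q ∈ A ∨ q ∈ B) (hwp : w p = 0) (hpos : ∀ q ∈ A, 0 < w q)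
    (hneg : ∀ q ∈ B, w q < 0) : A = S.filter fun q => 0 < w q := by
  ext q
  rw [Finset.mem_filter]
  refine ⟨fun hq => ⟨hA hq, hpos q hq⟩, fun ⟨hq, hw⟩ => ?_⟩
  refine (hcover q hq ?_).resolve_right fun h => lt_asymm hw (hneg q h)
  rintro rfl
  exact hw.ne' hwp

theorem odd_ncard_interiorIntersectionPoints {n k : ℕ}
    {S : Finset (EuclideanSpace ℝ (Fin n))} (hk : k ≠ 0) (hcard : S.card = 2 * k + 3)
    (hS : HasRigidDependences S) {a θ : EuclideanSpace ℝ (Fin n) → ℝ}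
    (h : IsDependencePencil S a θ) : Odd (interiorIntersectionPoints S k).ncard := by
  set pos : EuclideanSpace ℝ (Fin n) → Finset (EuclideanSpace ℝ (Fin n)) :=
    fun p => S.filter fun q => 0 < a q * (θ q - θ p) with hposdef
  set neg : EuclideanSpace ℝ (Fin n) → Finset (EuclideanSpace ℝ (Fin n)) :=
    fun p => S.filter fun q => a q * (θ q - θ p) < 0 with hnegdef
  set T := ∑ q ∈ S, signOf a q with hT
  have hTodd : Odd T := by
    rw [← Int.not_even_iff_odd, hT, even_sum_signOf_iff, hcard, Nat.not_even_iff_odd]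
    exact ⟨k + 1, by ring⟩
  set P := S.filter fun p => 2 * (∑ q ∈ S with θ q < θ p, signOf a q) + signOf a p = T with hP
  have hPodd : Odd P.card := by
    rw [hP, odd_card_filter_crossing S θ h.injOn _ (fun x _ => signOf_eq_or a x) T hTodd]
    obtain ⟨j, hj⟩ := hTodd
    omega
  have hmemP : ∀ p ∈ S, p ∈ P ↔ (pos p).card = k + 1 ∧ (neg p).card = k + 1 := by
    intro p hp
    have h1 := card_pos_sub_card_neg S a θ h.ne_zero h.injOn hp
    have h2 := card_pos_add_card_neg S a θ h.ne_zero h.injOn hp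
    rw [hP, Finset.mem_filter, and_iff_right hp]
    simp only [hposdef, hnegdef]
    omega
  have hposS : ∀ p, pos p ⊆ S := fun p => Finset.filter_subset _ _
  have hnegS : ∀ p, neg p ⊆ S := fun p => Finset.filter_subset _ _
  have hppos : ∀ p, p ∉ pos p := fun p => by simp [hposdef]
  have hpneg : ∀ p, p ∉ neg p := fun p => by simp [hnegdef]
  have hdisj : ∀ p, Disjoint (pos p) (neg p) := fun p => by
    rw [Finset.disjoint_filter]
    intro q _ h1 h2
    exact lt_asymm h1 h2
  have hcover : ∀ p ∈ S, ∀ q ∈ S, q ≠ p → q ∈ pos p ∨ q ∈ neg p := by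
    intro p hp q hq hqp
    simp only [hposdef, hnegdef, Finset.mem_filter, hq, true_and]
    exact (mul_ne_zero (h.ne_zero q hq)
      (sub_ne_zero.2 fun e => hqp (h.injOn hq hp e))).lt_or_gt.symm
  have hex : ∀ p ∈ P, ∃ x, x ∈ simplexInterior (pos p) ∧ x ∈ simplexInterior (neg p) := by
    intro p hp
    have hpS : p ∈ S := Finset.mem_of_mem_filter p hp
    obtain ⟨hc1, hc2⟩ := (hmemP p hpS).1 hp
    obtain ⟨x, l, m, hl, hm, hl', hm'⟩ := h.exists_isBarycentric (hposS p) (hnegS p)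
      (Finset.card_pos.1 (by omega)) (Finset.card_pos.1 (by omega)) (hcover p hpS)
      (Or.inl ⟨fun q hq => (Finset.mem_filter.1 hq).2, fun q hq => (Finset.mem_filter.1 hq).2⟩)
    exact ⟨x, mem_simplexInterior_of_isBarycentric hS (hposS p) (by omega) hl hl',
      mem_simplexInterior_of_isBarycentric hS (hnegS p) (by omega) hm hm'⟩
  choose! f hf using hex
  have hsimp : ∀ p ∈ P, pos p ∈ simplicesOn S k ∧ neg p ∈ simplicesOn S k := fun p hp =>
    have := (hmemP p (Finset.mem_of_mem_filter p hp)).1 hp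
    ⟨⟨hposS p, this.1⟩, ⟨hnegS p, this.2⟩⟩
  have himage : interiorIntersectionPoints S k = f '' P := by
    ext x
    constructor
    · rintro ⟨s, hs, t, ht, hst, hxs, hxt⟩
      have hd := hS.disjoint_of_mem_simplexInterior hcard hs ht hst hxs hxt
      have hc : (S \ (s ∪ t)).card = 1 := by
        rw [Finset.card_sdiff_of_subset (Finset.union_subset hs.1 ht.1),
          Finset.card_union_of_disjoint hd, hs.2, ht.2, hcard]
        omega
      obtain ⟨p, hp⟩ := Finset.card_eq_one.1 hc
      have hmem : ∀ q, q ∈ S ∧ ¬ (q ∈ s ∨ q ∈ t) ↔ q = p := fun q => by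
        rw [← Finset.mem_union, ← Finset.mem_sdiff, hp, Finset.mem_singleton]
      obtain ⟨hpS, hpst⟩ := (hmem p).2 rfl
      rw [not_or] at hpst
      have hcov : ∀ q ∈ S, q ≠ p → q ∈ s ∨ q ∈ t := fun q hq hqp => by
        by_contra hcon
        exact hqp ((hmem q).1 ⟨hq, hcon⟩)
      have hp0 : a p * (θ p - θ p) = 0 := by simp
      have main : (s = pos p ∧ t = neg p) ∨ (s = neg p ∧ t = pos p) := by
        rcases h.separatesAt hS (by omega) hpS hs.1 ht.1 hd hpst.1 hpst.2 hxs.1 hxt.1 with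
          ⟨h1, h2⟩ | ⟨h1, h2⟩
        · refine Or.inl ⟨eq_filter_of_sign hs.1 hcov hp0 h1 h2, ?_⟩
          have := eq_filter_of_sign (w := fun q => -(a q * (θ q - θ p))) ht.1
            (fun q hq hqp => (hcov q hq hqp).symm) (by simp) (fun q hq => neg_pos.2 (h2 q hq))
            (fun q hq => neg_lt_zero.2 (h1 q hq))
          simpa only [neg_pos] using this
        · refine Or.inr ⟨?_, eq_filter_of_sign ht.1 (fun q hq hqp => (hcov q hq hqp).symm)
            hp0 h2 h1⟩
          have := eq_filter_of_sign (w := fun q => -(a q * (θ q - θ p))) hs.1 hcov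
            (by simp) (fun q hq => neg_pos.2 (h1 q hq)) (fun q hq => neg_lt_zero.2 (h2 q hq))
          simpa only [neg_pos] using this
      rcases main with ⟨rfl, rfl⟩ | ⟨rfl, rfl⟩
      · have hpP : p ∈ P := (hmemP p hpS).2 ⟨hs.2, ht.2⟩
        exact ⟨p, hpP, hS.eq_of_mem_simplexOn hpS hs.1 ht.1 hd hpst.1 hpst.2
          (hf p hpP).1.1 (hf p hpP).2.1 hxs.1 hxt.1⟩
      · have hpP : p ∈ P := (hmemP p hpS).2 ⟨ht.2, hs.2⟩
        exact ⟨p, hpP, hS.eq_of_mem_simplexOn hpS ht.1 hs.1 hd.symm hpst.2 hpst.1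
          (hf p hpP).1.1 (hf p hpP).2.1 hxt.1 hxs.1⟩
    · rintro ⟨p, hp, rfl⟩
      refine ⟨pos p, (hsimp p hp).1, neg p, (hsimp p hp).2, fun e => ?_, hf p hp⟩
      have hd := hdisj p
      rw [← e, disjoint_self, Finset.bot_eq_empty] at hd
      have := (hsimp p hp).1.2
      rw [hd, Finset.card_empty] at this
      omega
  have hinj : Set.InjOn f P := by
    intro p hp p' hp' hpp
    by_contra hne
    have hpS : p ∈ S := Finset.mem_of_mem_filter p hp
    have hpS' : p' ∈ S := Finset.mem_of_mem_filter p' hp'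
    obtain ⟨r, hr, hpr, hxr⟩ : ∃ r ∈ simplicesOn S k, p ∈ r ∧ f p ∈ simplexInterior r := by
      rw [hpp]
      rcases hcover p' hpS' p hpS hne with h' | h'
      exacts [⟨_, (hsimp p' hp').1, h', (hf p' hp').1⟩, ⟨_, (hsimp p' hp').2, h', (hf p' hp').2⟩]
    have d1 := hS.disjoint_of_mem_simplexInterior hcard hr (hsimp p hp).1
      (fun e => hppos p (e ▸ hpr)) hxr (hf p hp).1
    have d2 := hS.disjoint_of_mem_simplexInterior hcard hr (hsimp p hp).2
      (fun e => hpneg p (e ▸ hpr)) hxr (hf p hp).2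
    -- Three pairwise disjoint sets of `k + 1` points do not fit into `2 * k + 3` points, as `k ≠
    -- 0`.
    have hle := Finset.card_le_card
      (Finset.union_subset hr.1 (Finset.union_subset (hposS p) (hnegS p)))
    rw [Finset.card_union_of_disjoint (Finset.disjoint_union_right.2 ⟨d1, d2⟩),
      Finset.card_union_of_disjoint (hdisj p), hr.2, (hsimp p hp).1.2, (hsimp p hp).2.2] at hle
    omega
  rw [himage, hinj.ncard_image, Set.ncard_coe_finset]
  exact hPodd

/-! ### Odd dimension: symmetry of linking -/

section LinkedPartition

variable {n k : ℕ} {S s t : Finset (EuclideanSpace ℝ (Fin n))}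
  {a θ : EuclideanSpace ℝ (Fin n) → ℝ}

theorem IsDependencePencil.linked_iff (h : IsDependencePencil S a θ)
    (hS : HasRigidDependences S) (hk : k ≠ 0) (hs : s ∈ simplicesOn S k)
    (ht : t ∈ simplicesOn S k) (hd : Disjoint s t) (hcov : ∀ q ∈ S, q ∈ s ∨ q ∈ t) :
    Linked s t ↔ ∃! p, p ∈ s ∧ SeparatesAt a θ p (s.erase p) t := by
  have hsc := hs.2
  have htc := ht.2
  have hScard : 1 < S.card := by
    have := Finset.card_le_card hs.1
    omega
  have hsub : ∀ p, s.erase p ⊆ S := fun p => (Finset.erase_subset p s).trans hs.1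
  have hdis : ∀ p, Disjoint (s.erase p) t := fun p => hd.mono_left (Finset.erase_subset p s)
  have hnot : ∀ p ∈ s, p ∉ t := fun p hp => Finset.disjoint_left.1 hd hp
  have hsep : ∀ p ∈ s, (SeparatesAt a θ p (s.erase p) t ↔
      ∃ x, x ∈ simplexOn (s.erase p) ∧ x ∈ simplexOn t) := by
    intro p hp
    constructor
    · intro hp'
      obtain ⟨x, l, m, hl, hm, -, -⟩ := h.exists_isBarycentric (hsub p) ht.1
        (Finset.card_pos.1 (by rw [Finset.card_erase_of_mem hp]; omega))
        (Finset.card_pos.1 (by omega))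
        (fun q hq hqp => (hcov q hq).imp_left fun hqs => Finset.mem_erase.2 ⟨hqp, hqs⟩) hp'
      exact ⟨x, (mem_simplexOn_iff (hsub p)).2 ⟨l, hl⟩, (mem_simplexOn_iff ht.1).2 ⟨m, hm⟩⟩
    · rintro ⟨x, hx1, hx2⟩
      exact h.separatesAt hS hScard (hs.1 hp) (hsub p) ht.1 (hdis p)
        (Finset.notMem_erase p s) (hnot p hp) hx1 hx2
  have huniq : ∀ p ∈ s, ∀ x y, x ∈ simplexOn (s.erase p) → x ∈ simplexOn t →
      y ∈ simplexOn (s.erase p) → y ∈ simplexOn t → x = y := fun p hp x y h1 h2 h3 h4 =>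
    hS.eq_of_mem_simplexOn (hs.1 hp) (hsub p) ht.1 (hdis p) (Finset.notMem_erase p s)
      (hnot p hp) h1 h2 h3 h4
  -- On two facets at once, the coordinates in `s` and in `t` would all vanish at both `p` and `p'`,
  -- hence agree, despite disjoint supports. So distinct facets meet `t` at distinct points.
  have hfacet : ∀ p ∈ s, ∀ p' ∈ s, ∀ x, x ∈ simplexOn (s.erase p) → x ∈ simplexOn (s.erase p') →
      x ∈ simplexOn t → p = p' := by
    intro p hp p' hp' x h1 h2 h3
    by_contra hne
    obtain ⟨l, hl⟩ := (mem_simplexOn_iff (hsub p)).1 h1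
    obtain ⟨l', hl'⟩ := (mem_simplexOn_iff (hsub p')).1 h2
    obtain ⟨m, hm⟩ := (mem_simplexOn_iff ht.1).1 h3
    have hls := hl.mono (Finset.erase_subset p s)
    have hls' := hl'.mono (Finset.erase_subset p' s)
    obtain ⟨u, hu, v, hv, huv⟩ := Finset.one_lt_card.1 (show 1 < t.card by omega)
    have hus : u ∉ s := Finset.disjoint_right.1 hd hu
    have hvs : v ∉ s := Finset.disjoint_right.1 hd hv
    have hll := hls.eq_of_eq_at hS hls' (ht.1 hu) (ht.1 hv) huv
      (by rw [hls.eq_zero u hus, hls'.eq_zero u hus])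
      (by rw [hls.eq_zero v hvs, hls'.eq_zero v hvs])
    have hlp' : l p' = 0 := by
      rw [hll p' (hs.1 hp'), hl'.eq_zero p' (Finset.notMem_erase p' s)]
    have hlm := hls.eq_of_eq_at hS hm (hs.1 hp) (hs.1 hp') hne
      (by rw [hl.eq_zero p (Finset.notMem_erase p s), hm.eq_zero p (hnot p hp)])
      (by rw [hlp', hm.eq_zero p' (hnot p' hp')])
    obtain ⟨y, hy, hly⟩ := hls.exists_pos
    rw [hlm y (hs.1 hy), hm.eq_zero y (hnot y hy)] at hly
    exact lt_irrefl _ hly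
  constructor
  · rintro ⟨x, ⟨hxb, hxt⟩, hx⟩
    obtain ⟨p, hp, hxp⟩ := mem_simplexBoundary_iff.1 hxb
    refine ⟨p, ⟨hp, (hsep p hp).2 ⟨x, hxp, hxt⟩⟩, ?_⟩
    rintro p' ⟨hp', hs'⟩
    obtain ⟨y, hy1, hy2⟩ := (hsep p' hp').1 hs'
    have hyx : y = x := hx y ⟨mem_simplexBoundary_iff.2 ⟨p', hp', hy1⟩, hy2⟩
    subst hyx
    exact hfacet p' hp' p hp y hy1 hxp hy2
  · rintro ⟨p, ⟨hp, hps⟩, hpu⟩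
    obtain ⟨x, hx1, hx2⟩ := (hsep p hp).1 hps
    refine ⟨x, ⟨mem_simplexBoundary_iff.2 ⟨p, hp, hx1⟩, hx2⟩, ?_⟩
    rintro y ⟨hyb, hyt⟩
    obtain ⟨p', hp', hyp'⟩ := mem_simplexBoundary_iff.1 hyb
    have hpp : p' = p := hpu p' ⟨hp', (hsep p' hp').2 ⟨y, hyp', hyt⟩⟩
    subst hpp
    exact huniq p' hp' y x hyp' hyt hx1 hx2

/-- `p` is a source or a sink of the tournament on `S` given by the planar vectors
`z q • (1, θ q)`. -/
def IsExtremal {ι : Type*} (S : Finset ι) (z θ : ι → ℝ) (p : ι) : Prop :=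
  (∀ q ∈ S, q ≠ p → 0 < z p * (z q * (θ q - θ p))) ∨
    ∀ q ∈ S, q ≠ p → z p * (z q * (θ q - θ p)) < 0

open Classical in
/-- The function `a` with its sign changed outside `s`. -/
noncomputable def flipOutside {ι : Type*} (s : Finset ι) (a : ι → ℝ) (q : ι) : ℝ :=
  if q ∈ s then a q else -a q

/-- Flipping signs outside `s` turns opposite signs on the two parts into equal ones; the factor at
`p` at most exchanges source and sink. -/
theorem separatesAt_erase_iff {ι : Type*} [DecidableEq ι] {S s t : Finset ι} {a θ : ι → ℝ}
    (ha : ∀ q ∈ S, a q ≠ 0) (hs : s ⊆ S) (ht : t ⊆ S) (hd : Disjoint s t)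
    (hcov : ∀ q ∈ S, q ∈ s ∨ q ∈ t) {p : ι} (hp : p ∈ s) :
    SeparatesAt a θ p (s.erase p) t ↔ IsExtremal S (flipOutside s a) θ p := by
  have hnt : ∀ q ∈ t, q ∉ s := fun q hq => Finset.disjoint_right.1 hd hq
  have hiff : ∀ (F : ℝ → Prop), (∀ q ∈ S, q ≠ p →
      F (flipOutside s a p * (flipOutside s a q * (θ q - θ p)))) ↔
      (∀ q ∈ s.erase p, F (a p * (a q * (θ q - θ p)))) ∧
        ∀ q ∈ t, F (-(a p * (a q * (θ q - θ p)))) := by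
    intro F
    constructor
    · intro H
      refine ⟨fun q hq => ?_, fun q hq => ?_⟩
      · have hq' := Finset.mem_erase.1 hq
        simpa [flipOutside, hp, hq'.2] using H q (hs hq'.2) hq'.1
      · have := H q (ht hq) (by rintro rfl; exact hnt q hq hp)
        simpa [flipOutside, hp, hnt q hq] using this
    · rintro ⟨H1, H2⟩ q hq hqp
      rcases hcov q hq with hqs | hqt
      · simpa [flipOutside, hp, hqs] using H1 q (Finset.mem_erase.2 ⟨hqp, hqs⟩)
      · simpa [flipOutside, hp, hnt q hqt] using H2 q hqt
  unfold IsExtremal SeparatesAt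
  rw [hiff fun r => 0 < r, hiff fun r => r < 0]
  rcases (ha p (hs hp)).lt_or_gt with hlt | hgt
  · have h1 : ∀ x, 0 < a p * x ↔ x < 0 := fun x => by simp [mul_pos_iff, hlt, hlt.not_gt]
    have h2 : ∀ x, a p * x < 0 ↔ 0 < x := fun x => by simp [mul_neg_iff, hlt, hlt.not_gt]
    rw [or_comm]
    simp only [neg_pos, neg_lt_zero, h1, h2]
  · have h1 : ∀ x, 0 < a p * x ↔ 0 < x := fun x => by simp [hgt]
    have h2 : ∀ x, a p * x < 0 ↔ x < 0 := fun x => by simp [mul_neg_iff, hgt, hgt.not_gt]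
    simp only [neg_pos, neg_lt_zero, h1, h2]

/-- The two flips differ by a global sign, which cancels in products of two values. -/
theorem isExtremal_flipOutside_comm {ι : Type*} {S s t : Finset ι} {a θ : ι → ℝ}
    (hd : Disjoint s t) (hcov : ∀ q ∈ S, q ∈ s ∨ q ∈ t) {p : ι} (hp : p ∈ S) :
    IsExtremal S (flipOutside s a) θ p ↔ IsExtremal S (flipOutside t a) θ p := by
  have hz : ∀ q ∈ S, flipOutside s a q = -flipOutside t a q := by
    intro q hq
    rcases hcov q hq with h | h
    · simp [flipOutside, h, Finset.disjoint_left.1 hd h]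
    · simp [flipOutside, h, Finset.disjoint_right.1 hd h]
  have key : ∀ q ∈ S, flipOutside s a p * (flipOutside s a q * (θ q - θ p)) =
      flipOutside t a p * (flipOutside t a q * (θ q - θ p)) := by
    intro q hq
    rw [hz p hp, hz q hq]
    ring
  unfold IsExtremal
  refine or_congr (forall₂_congr fun q hq => ?_) (forall₂_congr fun q hq => ?_) <;> rw [key q hq]

theorem flipOutside_ne_zero {ι : Type*} {S s : Finset ι} {a : ι → ℝ} (ha : ∀ q ∈ S, a q ≠ 0) :
    ∀ q ∈ S, flipOutside s a q ≠ 0 := by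
  intro q hq
  unfold flipOutside
  split_ifs
  exacts [ha q hq, neg_ne_zero.2 (ha q hq)]

/-- An extremal point comes with exactly one other extremal point. -/
theorem IsExtremal.exists_pair {ι : Type*} {S : Finset ι} {z θ : ι → ℝ}
    (hz : ∀ q ∈ S, z q ≠ 0) (hθ : Set.InjOn θ S) (hcard : 1 < S.card) {p : ι} (hp : p ∈ S)
    (h : IsExtremal S z θ p) :
    ∃ r ∈ S, r ≠ p ∧ ∀ q ∈ S, IsExtremal S z θ q ↔ q = p ∨ q = r := by
  have hsrc : ∀ u ∈ S, ∀ v ∈ S, (∀ q ∈ S, q ≠ u → 0 < z u * (z q * (θ q - θ u))) →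
      (∀ q ∈ S, q ≠ v → 0 < z v * (z q * (θ q - θ v))) → u = v := by
    intro u hu v hv h1 h2
    by_contra hne
    linarith [h1 v hv (Ne.symm hne), h2 u hu hne,
      show z u * (z v * (θ v - θ u)) = -(z v * (z u * (θ u - θ v))) by ring]
  have hsnk : ∀ u ∈ S, ∀ v ∈ S, (∀ q ∈ S, q ≠ u → z u * (z q * (θ q - θ u)) < 0) →
      (∀ q ∈ S, q ≠ v → z v * (z q * (θ q - θ v)) < 0) → u = v := by
    intro u hu v hv h1 h2
    by_contra hne
    linarith [h1 v hv (Ne.symm hne), h2 u hu hne,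
      show z u * (z v * (θ v - θ u)) = -(z v * (z u * (θ u - θ v))) by ring]
  have hboth : ∀ u, (∀ q ∈ S, q ≠ u → 0 < z u * (z q * (θ q - θ u))) →
      (∀ q ∈ S, q ≠ u → z u * (z q * (θ q - θ u)) < 0) → False := by
    intro u h1 h2
    obtain ⟨q, hq, hqu⟩ := Finset.exists_mem_ne hcard u
    exact lt_asymm (h1 q hq hqu) (h2 q hq hqu)
  rcases h with h | h
  · obtain ⟨r, hr, hr'⟩ := exists_sink_of_source S z θ hz hθ ⟨p, hp, h⟩
    refine ⟨r, hr, ?_, fun q hq => ⟨?_, ?_⟩⟩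
    · rintro rfl
      exact hboth r h hr'
    · exact Or.imp (fun h' => hsrc q hq p hp h' h) fun h' => hsnk q hq r hr h' hr'
    · rintro (rfl | rfl)
      exacts [Or.inl h, Or.inr hr']
  · obtain ⟨r, hr, hr'⟩ := exists_source_of_sink S z θ hz hθ ⟨p, hp, h⟩
    refine ⟨r, hr, ?_, fun q hq => ⟨?_, ?_⟩⟩
    · rintro rfl
      exact hboth r hr' h
    · rintro (h' | h')
      exacts [Or.inr (hsrc q hq r hr h' hr'), Or.inl (hsnk q hq p hp h' h)]
    · rintro (rfl | rfl)
      exacts [Or.inr h, Or.inl hr']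

theorem existsUnique_isExtremal_swap {ι : Type*} {S s t : Finset ι} {z θ : ι → ℝ}
    (hz : ∀ q ∈ S, z q ≠ 0) (hθ : Set.InjOn θ S) (hcard : 1 < S.card) (hs : s ⊆ S) (ht : t ⊆ S)
    (hd : Disjoint s t) (hcov : ∀ q ∈ S, q ∈ s ∨ q ∈ t)
    (h : ∃! p, p ∈ s ∧ IsExtremal S z θ p) : ∃! p, p ∈ t ∧ IsExtremal S z θ p := by
  obtain ⟨p, ⟨hp, hpe⟩, hpu⟩ := h
  obtain ⟨r, hr, hrp, hiff⟩ := hpe.exists_pair hz hθ hcard (hs hp)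
  have hre : IsExtremal S z θ r := (hiff r hr).2 (Or.inr rfl)
  have hrt : r ∈ t := (hcov r hr).resolve_left fun hrs => hrp (hpu r ⟨hrs, hre⟩)
  refine ⟨r, ⟨hrt, hre⟩, ?_⟩
  rintro q ⟨hqt, hqe⟩
  refine ((hiff q (ht hqt)).1 hqe).resolve_left ?_
  rintro rfl
  exact Finset.disjoint_left.1 hd hp hqt

theorem mem_or_mem_of_card (hcard : S.card = 2 * k + 2) (hs : s ∈ simplicesOn S k)
    (ht : t ∈ simplicesOn S k) (hd : Disjoint s t) : ∀ q ∈ S, q ∈ s ∨ q ∈ t := by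
  have hunion : s ∪ t = S := Finset.eq_of_subset_of_card_le (Finset.union_subset hs.1 ht.1) (by
    rw [Finset.card_union_of_disjoint hd, hs.2, ht.2, hcard]
    omega)
  intro q hq
  rwa [← Finset.mem_union, hunion]

theorem IsDependencePencil.linked_iff_isExtremal (h : IsDependencePencil S a θ)
    (hS : HasRigidDependences S) (hk : k ≠ 0) (hcard : S.card = 2 * k + 2)
    (hs : s ∈ simplicesOn S k) (ht : t ∈ simplicesOn S k) (hd : Disjoint s t) :
    Linked s t ↔ ∃! p, p ∈ s ∧ IsExtremal S (flipOutside s a) θ p := by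
  have hcov := mem_or_mem_of_card hcard hs ht hd
  rw [h.linked_iff hS hk hs ht hd hcov]
  exact existsUnique_congr fun p =>
    and_congr_right fun hp => separatesAt_erase_iff h.ne_zero hs.1 ht.1 hd hcov hp

theorem IsDependencePencil.linked_symm (h : IsDependencePencil S a θ)
    (hS : HasRigidDependences S) (hk : k ≠ 0) (hcard : S.card = 2 * k + 2)
    (hs : s ∈ simplicesOn S k) (ht : t ∈ simplicesOn S k) (hd : Disjoint s t)
    (hl : Linked s t) : Linked t s := by
  have hcov := mem_or_mem_of_card hcard hs ht hd
  rw [h.linked_iff_isExtremal hS hk hcard hs ht hd] at hl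
  rw [h.linked_iff_isExtremal hS hk hcard ht hs hd.symm]
  have := existsUnique_isExtremal_swap (flipOutside_ne_zero h.ne_zero) h.injOn (by omega)
    hs.1 ht.1 hd hcov hl
  refine (existsUnique_congr fun p => and_congr_right fun hp => ?_).1 this
  exact isExtremal_flipOutside_comm hd hcov (ht.1 hp)

end LinkedPartition

/-! ### Odd dimension: counting incidences modulo 2 -/

section Counting

variable {ι : Type*} [DecidableEq ι]

/-- The sets `s ∋ p` for which the pencil separates `s \ {p}` from the complement of `s` at `p`
consist of `p` and one of the two sides of `p`. -/
theorem separatesAt_erase_sdiff_iff {S s : Finset ι} {a θ : ι → ℝ} (ha : ∀ q ∈ S, a q ≠ 0)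
    (hθ : Set.InjOn θ S) (hs : s ⊆ S) {p : ι} (hp : p ∈ S) :
    (p ∈ s ∧ SeparatesAt a θ p (s.erase p) (S \ s)) ↔
      s = insert p (S.filter fun q => 0 < a q * (θ q - θ p)) ∨
        s = insert p (S.filter fun q => a q * (θ q - θ p) < 0) := by
  have hne : ∀ q ∈ S, q ≠ p → a q * (θ q - θ p) ≠ 0 := fun q hq hqp =>
    mul_ne_zero (ha q hq) (sub_ne_zero.2 fun e => hqp (hθ hq hp e))
  have hp0 : a p * (θ p - θ p) = 0 := by simp
  constructor
  · rintro ⟨hps, h | h⟩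
    · left
      ext q
      rw [Finset.mem_insert, Finset.mem_filter]
      constructor
      · intro hq
        by_cases hqp : q = p
        · exact Or.inl hqp
        · exact Or.inr ⟨hs hq, h.1 q (Finset.mem_erase.2 ⟨hqp, hq⟩)⟩
      · rintro (rfl | ⟨hq, hpos⟩)
        · exact hps
        · by_contra hqs
          exact lt_asymm hpos (h.2 q (Finset.mem_sdiff.2 ⟨hq, hqs⟩))
    · right
      ext q
      rw [Finset.mem_insert, Finset.mem_filter]
      constructor
      · intro hq
        by_cases hqp : q = p
        · exact Or.inl hqp
        · exact Or.inr ⟨hs hq, h.1 q (Finset.mem_erase.2 ⟨hqp, hq⟩)⟩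
      · rintro (rfl | ⟨hq, hneg⟩)
        · exact hps
        · by_contra hqs
          exact lt_asymm hneg (h.2 q (Finset.mem_sdiff.2 ⟨hq, hqs⟩))
  · rintro (rfl | rfl)
    · refine ⟨Finset.mem_insert_self _ _, Or.inl ⟨fun q hq => ?_, fun q hq => ?_⟩⟩
      · rw [Finset.mem_erase, Finset.mem_insert, Finset.mem_filter] at hq
        exact (hq.2.resolve_left hq.1).2
      · rw [Finset.mem_sdiff, Finset.mem_insert, Finset.mem_filter, not_or, not_and, not_lt] at hq
        exact (hq.2.2 hq.1).lt_of_ne (hne q hq.1 hq.2.1)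
    · refine ⟨Finset.mem_insert_self _ _, Or.inr ⟨fun q hq => ?_, fun q hq => ?_⟩⟩
      · rw [Finset.mem_erase, Finset.mem_insert, Finset.mem_filter] at hq
        exact (hq.2.resolve_left hq.1).2
      · rw [Finset.mem_sdiff, Finset.mem_insert, Finset.mem_filter, not_or, not_and, not_lt] at hq
        exact (hq.2.2 hq.1).lt_of_ne' (hne q hq.1 hq.2.1)

open Classical in
-- The sides at `p` have `2 * k + 1` points together, so at most one has `k`. For `p ≠ m` it must
-- also contain `m`, and the sign of `a m` tells which side does.
theorem odd_card_separating_sets_iff {S : Finset ι} {a θ : ι → ℝ} (ha : ∀ q ∈ S, a q ≠ 0)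
    (hθ : Set.InjOn θ S) {k : ℕ} (hcard : S.card = 2 * k + 2) {m : ι} (hm : m ∈ S)
    (hmax : ∀ q ∈ S, θ q ≤ θ m) {p : ι} (hp : p ∈ S) :
    Odd (((S.powersetCard (k + 1)).filter fun s => m ∈ s).filter fun s =>
      p ∈ s ∧ SeparatesAt a θ p (s.erase p) (S \ s)).card ↔
      if p = m then
        (∑ q ∈ S, signOf a q - (2 * (∑ q ∈ S with θ q < θ p, signOf a q) + signOf a p) = 1 ∨
        ∑ q ∈ S, signOf a q - (2 * (∑ q ∈ S with θ q < θ p, signOf a q) + signOf a p) = -1)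
      else 2 * (∑ q ∈ S with θ q < θ p, signOf a q) + signOf a p =
        ∑ q ∈ S, signOf a q + signOf a m := by
  have hsub := card_pos_sub_card_neg S a θ ha hθ hp
  have hadd := card_pos_add_card_neg S a θ ha hθ hp
  set pos := S.filter fun q => 0 < a q * (θ q - θ p) with hpos
  set neg := S.filter fun q => a q * (θ q - θ p) < 0 with hneg
  have hppos : p ∉ pos := by simp [hpos]
  have hpneg : p ∉ neg := by simp [hneg]
  have hle : (((S.powersetCard (k + 1)).filter fun s => m ∈ s).filter fun s =>
      p ∈ s ∧ SeparatesAt a θ p (s.erase p) (S \ s)) =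
      ({insert p pos, insert p neg} : Finset (Finset ι)).filter fun s =>
        s.card = k + 1 ∧ m ∈ s := by
    ext s
    simp only [Finset.mem_filter, Finset.mem_powersetCard, Finset.mem_insert,
      Finset.mem_singleton]
    constructor
    · rintro ⟨⟨⟨hs, hc⟩, hms⟩, hsep⟩
      exact ⟨(separatesAt_erase_sdiff_iff ha hθ hs hp).1 hsep, hc, hms⟩
    · rintro ⟨h, hc, hms⟩
      have hs : s ⊆ S := by
        rcases h with rfl | rfl <;>
          exact Finset.insert_subset hp (Finset.filter_subset _ _)
      exact ⟨⟨⟨hs, hc⟩, hms⟩, (separatesAt_erase_sdiff_iff ha hθ hs hp).2 h⟩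
  have hcp : (insert p pos).card = pos.card + 1 := Finset.card_insert_of_notMem hppos
  have hcn : (insert p neg).card = neg.card + 1 := Finset.card_insert_of_notMem hpneg
  have hodd : Odd (({insert p pos, insert p neg} : Finset (Finset ι)).filter fun s =>
        s.card = k + 1 ∧ m ∈ s).card ↔
      (pos.card = k ∧ m ∈ insert p pos) ∨ (neg.card = k ∧ m ∈ insert p neg) := by
    rw [Finset.filter_insert, Finset.filter_singleton, hcp, hcn]
    by_cases h1 : pos.card = k
    · have h2 : neg.card ≠ k := by omega
      simp only [h1, h2, Nat.add_right_cancel_iff, true_and, false_and, if_false, or_false]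
      split_ifs with h
      exacts [iff_of_true (by simp) h, iff_of_false (by simp) h]
    · simp only [h1, Nat.add_right_cancel_iff, false_and, if_false, false_or]
      split_ifs with h
      exacts [iff_of_true (by simp) h, iff_of_false (by simp) h]
  rw [hle, hodd]
  split_ifs with hpm
  · subst hpm
    simp only [Finset.mem_insert_self, and_true]
    omega
  · have hlt : 0 < θ m - θ p := sub_pos.2 ((hmax p hp).lt_of_ne fun e => hpm (hθ hp hm e))
    have hmp : m ≠ p := Ne.symm hpm
    simp only [Finset.mem_insert, hmp, false_or, hpos, hneg, Finset.mem_filter, hm, true_and,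
      mul_pos_iff_of_pos_right hlt]
    rw [← hpos, ← hneg]
    rcases (ha m hm).lt_or_gt with hn | hn
    · have h1 : a m * (θ m - θ p) < 0 := mul_neg_of_neg_of_pos hn hlt
      have h2 : signOf a m = -1 := if_neg hn.not_gt
      simp only [h1, hn.not_gt, h2, and_true, and_false, false_or]
      omega
    · have h1 : ¬ a m * (θ m - θ p) < 0 := (mul_pos hn hlt).not_gt
      have h2 : signOf a m = 1 := if_pos hn
      simp only [h1, hn, h2, and_true, and_false, or_false]
      omega

open Classical in
theorem odd_sum_card_separating_sets {S : Finset ι} {a θ : ι → ℝ} (ha : ∀ q ∈ S, a q ≠ 0)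
    (hθ : Set.InjOn θ S) {k : ℕ} (hcard : S.card = 2 * k + 2) {m : ι} (hm : m ∈ S)
    (hmax : ∀ q ∈ S, θ q ≤ θ m) :
    Odd (∑ p ∈ S, (((S.powersetCard (k + 1)).filter fun s => m ∈ s).filter fun s =>
      p ∈ s ∧ SeparatesAt a θ p (s.erase p) (S \ s)).card) := by
  have hlt : ∀ p ∈ S.erase m, θ p < θ m := fun p hp =>
    (hmax p (Finset.mem_of_mem_erase hp)).lt_of_ne fun e =>
      Finset.ne_of_mem_erase hp (hθ (Finset.mem_of_mem_erase hp) hm e)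
  rw [Finset.odd_sum_iff_odd_card_odd, Finset.filter_congr fun p hp =>
    odd_card_separating_sets_iff ha hθ hcard hm hmax hp]
  have hTeven : Even (∑ q ∈ S, signOf a q) := by
    rw [even_sum_signOf_iff, hcard]
    exact ⟨k + 1, by ring⟩
  have hsum : ∑ q ∈ S, signOf a q = signOf a m + ∑ q ∈ S.erase m, signOf a q :=
    (Finset.add_sum_erase S _ hm).symm
  set T := ∑ q ∈ S, signOf a q with hT
  have hLodd : Odd (T + signOf a m) := by
    rcases signOf_eq_or a m with e | e <;> rw [e]
    exacts [hTeven.add_one, hTeven.add_odd (by decide)]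
  have hcross := odd_card_filter_crossing (S.erase m) θ
    (hθ.mono (by exact_mod_cast Finset.erase_subset m S)) (signOf a)
    (fun x _ => signOf_eq_or a x) (T + signOf a m) hLodd
  have hbelow : S.filter (fun q => θ q < θ m) = S.erase m := by
    ext q
    rw [Finset.mem_filter]
    refine ⟨fun ⟨hq, hqm⟩ => Finset.mem_erase.2 ⟨?_, hq⟩, fun hq =>
      ⟨Finset.mem_of_mem_erase hq, hlt q hq⟩⟩
    rintro rfl
    exact lt_irrefl _ hqm
  have hbelow' : ∀ p ∈ S.erase m,
      S.filter (fun q => θ q < θ p) = (S.erase m).filter fun q => θ q < θ p := by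
    intro p hp
    rw [Finset.filter_erase, Finset.erase_eq_of_notMem]
    rw [Finset.mem_filter, not_and, not_lt]
    exact fun _ => (hlt p hp).le
  have hinsert : ∀ (F : ι → Prop) [DecidablePred F],
      S.filter F = (insert m (S.erase m)).filter F := fun F _ => by
    rw [Finset.insert_erase hm]
  rw [hinsert, Finset.filter_insert]
  simp only [if_true, hbelow]
  rw [Finset.filter_congr (s := S.erase m) (q := fun p =>
    2 * (∑ q ∈ S.erase m with θ q < θ p, signOf a q) + signOf a p = T + signOf a m)
    fun p hp => by rw [if_neg (Finset.ne_of_mem_erase hp), hbelow' p hp]]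
  obtain ⟨j, hj⟩ := hTeven
  -- The walk over `S.erase m` ends at `T - signOf a m`. It fails to cross the level an odd number
  -- of times exactly when the point `m` itself contributes, so the total is always odd.
  split_ifs with hcond
  · rw [Finset.card_insert_of_notMem (by simp), Nat.odd_add_one, hcross]
    rcases signOf_eq_or a m with e | e <;> rw [e] at hcond hsum ⊢ <;> omega
  · rw [hcross]
    rcases signOf_eq_or a m with e | e <;> rw [e] at hcond hsum ⊢ <;> omega

end Counting

theorem odd_ncard_linkedPairs {n k : ℕ} {S : Finset (EuclideanSpace ℝ (Fin n))} (hk : k ≠ 0)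
    (hcard : S.card = 2 * k + 2) (hS : HasRigidDependences S)
    {a θ : EuclideanSpace ℝ (Fin n) → ℝ} (h : IsDependencePencil S a θ) :
    Odd (linkedPairs S k).ncard := by
  classical
  -- Requiring `m ∈ s` selects one member of each complementary pair.
  obtain ⟨m, hm, hmax⟩ := S.exists_max_image θ (Finset.card_pos.1 (by omega))
  set P := (S.powersetCard (k + 1)).filter fun s => m ∈ s with hP
  have hmemP : ∀ s ∈ P, s ∈ simplicesOn S k ∧ S \ s ∈ simplicesOn S k ∧ m ∈ s := by
    intro s hs
    rw [hP, Finset.mem_filter, Finset.mem_powersetCard] at hs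
    refine ⟨hs.1, ⟨Finset.sdiff_subset, ?_⟩, hs.2⟩
    rw [Finset.card_sdiff_of_subset hs.1.1, hs.1.2, hcard]
    omega
  set F := P.filter fun s => Linked s (S \ s) with hF
  have hcompl : ∀ s t, s ∈ simplicesOn S k → t ∈ simplicesOn S k → Disjoint s t → S \ s = t := by
    intro s t hs ht hd
    ext q
    rw [Finset.mem_sdiff]
    exact ⟨fun hq => (mem_or_mem_of_card hcard hs ht hd q hq.1).resolve_left hq.2,
      fun hq => ⟨ht.1 hq, Finset.disjoint_right.1 hd hq⟩⟩
  have himage : linkedPairs S k = (fun s => s(s, S \ s)) '' (F : Set (Finset _)) := by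
    ext z
    constructor
    · rintro ⟨s, hs, t, ht, hd, hl, rfl⟩
      rcases mem_or_mem_of_card hcard hs ht hd m hm with hms | hmt
      · have e := hcompl s t hs ht hd
        subst e
        exact ⟨s, by simpa [hF, hP, hl, hms, simplicesOn] using hs, rfl⟩
      · have e := hcompl t s ht hs hd.symm
        subst e
        have hl' := h.linked_symm hS hk hcard hs ht hd hl
        exact ⟨t, by simpa [hF, hP, hl', hmt, simplicesOn] using ht, Sym2.eq_swap⟩
    · rintro ⟨s, hs, rfl⟩
      rw [hF, Finset.coe_filter] at hs
      obtain ⟨h1, h2, -⟩ := hmemP s hs.1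
      exact ⟨s, h1, S \ s, h2, Finset.disjoint_sdiff, hs.2, rfl⟩
  have hinj : Set.InjOn (fun s => s(s, S \ s)) (F : Set (Finset _)) := by
    intro s hs s' hs' e
    have hms := (hmemP s (Finset.mem_of_mem_filter s hs)).2.2
    have hms' := (hmemP s' (Finset.mem_of_mem_filter s' hs')).2.2
    rcases Sym2.eq_iff.1 e with ⟨e, -⟩ | ⟨e, -⟩
    · exact e
    · rw [e, Finset.mem_sdiff] at hms
      exact absurd hms' hms.2
  rw [himage, hinj.ncard_image, Set.ncard_coe_finset]
  -- There are at most two extremal points, so "exactly one in `s`" can be read as a parity.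
  have hodd : ∀ s ∈ P, (Linked s (S \ s) ↔
      Odd (S.filter fun p => p ∈ s ∧ SeparatesAt a θ p (s.erase p) (S \ s)).card) := by
    intro s hs
    obtain ⟨h1, h2, -⟩ := hmemP s hs
    have hcov := mem_or_mem_of_card hcard h1 h2 Finset.disjoint_sdiff
    rw [h.linked_iff_isExtremal hS hk hcard h1 h2 Finset.disjoint_sdiff,
      Finset.filter_congr fun p _ => and_congr_right fun hp =>
        separatesAt_erase_iff h.ne_zero h1.1 h2.1 Finset.disjoint_sdiff hcov hp]
    set Q := S.filter fun p => p ∈ s ∧ IsExtremal S (flipOutside s a) θ p with hQ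
    have hmemQ : ∀ p, p ∈ Q ↔ p ∈ s ∧ IsExtremal S (flipOutside s a) θ p := fun p => by
      rw [hQ, Finset.mem_filter, and_iff_right_of_imp fun hp => h1.1 hp.1]
    have hle : Q.card ≤ 2 := by
      rcases Q.eq_empty_or_nonempty with hQe | ⟨p, hp⟩
      · simp [hQe]
      · have hp' := (hmemQ p).1 hp
        obtain ⟨r, -, -, hr⟩ := hp'.2.exists_pair (flipOutside_ne_zero h.ne_zero) h.injOn
          (by omega) (h1.1 hp'.1)
        refine (Finset.card_le_card (t := {p, r}) fun q hq => ?_).trans Finset.card_le_two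
        have hq' := (hmemQ q).1 hq
        simpa using (hr q (h1.1 hq'.1)).1 hq'.2
    have hone : Odd Q.card ↔ Q.card = 1 := by
      constructor
      · rintro ⟨j, hj⟩
        omega
      · intro e
        rw [e]
        exact odd_one
    rw [hone, Finset.card_eq_one_iff_existsUnique]
    exact existsUnique_congr fun p => (hmemQ p).symm
  rw [hF, Finset.filter_congr hodd, ← Finset.odd_sum_iff_odd_card_odd]
  have hswap := Finset.sum_card_bipartiteAbove_eq_sum_card_bipartiteBelow (s := P) (t := S)
    fun s p => p ∈ s ∧ SeparatesAt a θ p (s.erase p) (S \ s)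
  simp only [Finset.bipartiteAbove, Finset.bipartiteBelow] at hswap
  rw [hswap]
  exact odd_sum_card_separating_sets h.ne_zero h.injOn hcard hm hmax

theorem theorem2p5 (n : ℕ) (S : Finset (EuclideanSpace ℝ (Fin n))) (hcard : S.card = n + 3)
    (hS : InGeneralPosition (S : Set (EuclideanSpace ℝ (Fin n)))) :
    (Even n → Odd (interiorIntersectionPoints S (n / 2)).ncard) ∧
    (Odd n →
      (∀ s ∈ simplicesOn S ((n + 1) / 2), ∀ t ∈ simplicesOn S ((n + 1) / 2), Disjoint s t →
        (Linked s t ↔ Linked t s)) ∧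
      Odd (linkedPairs S ((n + 1) / 2)).ncard) := by
  have hrigid := hasRigidDependences_of_inGeneralPosition hcard hS
  obtain ⟨a, θ, h⟩ := hrigid.exists_isDependencePencil hcard
  -- `ℝ⁰` has no three distinct points; hence the simplices below have positive dimension.
  have hn : n ≠ 0 := by
    rintro rfl
    have : S.card ≤ 1 := Finset.card_le_one.2 fun x _ y _ => Subsingleton.elim x y
    omega
  refine ⟨fun ⟨k, hk⟩ => ?_, fun ⟨k, hk⟩ => ?_⟩
  · exact odd_ncard_interiorIntersectionPoints (by omega) (by omega) hrigid h
  · have hk0 : (n + 1) / 2 ≠ 0 := by omega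
    have hc : S.card = 2 * ((n + 1) / 2) + 2 := by omega
    exact ⟨fun s hs t ht hd => ⟨h.linked_symm hrigid hk0 hc hs ht hd,
      h.linked_symm hrigid hk0 hc ht hs hd.symm⟩, odd_ncard_linkedPairs hk0 hc hrigid h⟩
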